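/- Fix $N\in\mathbb{N}$. For every $T>0$ let $H_T:[0,1]\to\mathbb{C}^{N\times N}$ be a Hermitian-matrix-valued function (a Hamiltonian in the dimensionless time $s=t/T$) that is twice differentiable on $[0,1]$, and let $U_T(s,0)$ be its time-evolution operator, i.e. the solution on $[0,1]$ of $i\,\partial_sU_T(s,0)=T\,H_T(s)\,U_T(s,0)$ with $U_T(0,0)=\mathbb{1}$. Let $G_T(s)$, $s\in[0,1]$, be normalized eigenvectors of $H_T(s)$ belonging to a continuous eigenvalue $E_T(s)$ that is non-degenerate (has a one-dimensional eigenspace) for every $s\in[0,1]$, and put $P_{G_T}(1)=|G_T(1)\rangle\langle G_T(1)|$. Let $\gamma_{\min}(T)$ be the infimum of $|\lambda-\mu|$ over all $s\in[0,1]$ and all pairs of distinct eigenvalues $\lambda\neq\mu$ of $H_T(s)$ (with $\gamma_{\min}(T)=\infty$ if there is no such pair), and let $\|\dot H_T\|$ and $\|\ddot H_T\|$ be the suprema over $s\in[0,1]$ of the operator norms of $\dot H_T(s)$ and $\ddot H_T(s)$. If $\|\dot H_T\|$ and $\gamma_{\min}(T)^{-1}$ are bounded above by constants independent of $T$ for all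 $T>0$ (in particular $\gamma_{\min}(T)>0$), and $\|\ddot H_T\|\in o(T)$ as $T\to\infty$, then $$\lim_{T\to\infty}\bigl\|(\mathbb{1}-P_{G_T}(1))\,U_T(1,0)\,G_T(0)\bigr\|=0 .$$ -/

import Mathlib

open Set Filter Topology
open scoped ENNReal NNReal Matrix.Norms.L2Operator

noncomputable section

namespace Adiabatic

/-- Complex `N × N` matrices, normed by the operator norm of the Euclidean norm on `ℂ^N`. -/
abbrev Mat (N : ℕ) := Matrix (Fin N) (Fin N) ℂ

/-- The state space `ℂ^N` with its Euclidean norm. -/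
abbrev State (N : ℕ) := EuclideanSpace ℂ (Fin N)

/-- The first derivative of a matrix-valued function on `[0,1]` (one-sided at the end points). -/
def dot {N : ℕ} (H : ℝ → Mat N) : ℝ → Mat N :=
  derivWithin H (Icc 0 1)

/-- `H` is twice differentiable on `[0,1]` (one-sided at the end points); the second derivative
need not be continuous. -/
def TwiceDifferentiable {N : ℕ} (H : ℝ → Mat N) : Prop :=
  DifferentiableOn ℝ H (Icc 0 1) ∧ DifferentiableOn ℝ (dot H) (Icc 0 1)

/-- The supremum over `s ∈ [0,1]` of the operator norm of `A s`, possibly `∞`. -/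
def supNorm {N : ℕ} (A : ℝ → Mat N) : ℝ≥0∞ :=
  ⨆ s ∈ Icc (0 : ℝ) 1, ‖A s‖ₑ

/-- The minimum eigenvalue gap of `H` on `[0,1]`: the infimum of `|E - E'|` over all `s ∈ [0,1]`
and all pairs of distinct eigenvalues `E ≠ E'` of `H s`. It is `∞` if there are no such pairs. -/
def gapMin {N : ℕ} (H : ℝ → Mat N) : ℝ≥0∞ :=
  ⨅ s ∈ Icc (0 : ℝ) 1, (spectrum ℂ (H s)).einfsep

/-- `G s` is a normalized eigenvector of `H s` for an eigenvalue `E s` that is non-degenerate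
(its eigenspace is a line) for every `s ∈ [0,1]` and that follows a continuous energy level.
The phase of `G s` is arbitrary. -/
structure IsNondegenerateEigenstate {N : ℕ} (H : ℝ → Mat N) (E : ℝ → ℝ) (G : ℝ → State N) :
    Prop where
  continuousOn_energy : ContinuousOn E (Icc 0 1)
  norm_eq_one : ∀ s ∈ Icc (0 : ℝ) 1, ‖G s‖ = 1
  eigenvector : ∀ s ∈ Icc (0 : ℝ) 1, Matrix.toEuclideanLin (H s) (G s) = (E s : ℂ) • G s
  nondegenerate : ∀ s ∈ Icc (0 : ℝ) 1,
    Module.finrank ℂ (Module.End.eigenspace (Matrix.toEuclideanLin (H s)) (E s : ℂ)) = 1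

/-- `U s` is the time-evolution operator `U(s,0)` in the dimensionless time `s = t / T`, for total
evolution time `T` (units with `ħ = 1`): the solution on `[0,1]` of the Schrödinger equation
`i U' = T H U` with `U 0 = 1`. -/
structure IsEvolution {N : ℕ} (T : ℝ) (H U : ℝ → Mat N) : Prop where
  initial : U 0 = 1
  schrodinger : ∀ s ∈ Icc (0 : ℝ) 1,
    HasDerivWithinAt U ((-(Complex.I * (T : ℂ))) • (H s * U s)) (Icc 0 1) s

/-- The projector `|v⟩⟨v|`. -/
def proj {N : ℕ} (v : State N) : Mat N :=
  Matrix.of fun i j => v i * star (v j)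

/-- The error in the adiabatic approximation, `‖(1 - P_G(1)) U(1,0) |G(0)⟩‖`. -/
def adiabaticError {N : ℕ} (G : ℝ → State N) (U : ℝ → Mat N) : ℝ :=
  ‖Matrix.toEuclideanLin ((1 - proj (G 1)) * U 1) (G 0)‖

end Adiabatic

end

/-!
Let `p` be the spectral projection of `h` at the level `e` and `s` its reduced resolvent, the group
inverse of `k = h - e`. The resolvent-type identities
`p - p₀ = -s₀ (k - k₀) p - p₀ (k - k₀) s` and
`s - s₀ = -s (k - k₀) s₀ - s (p - p₀) - (p - p₀) s₀`
show that `p` and `s` are differentiable along `h`, with derivatives bounded in terms of `‖h'‖` and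
`‖s‖`, and the norm of `s` is at most the inverse of the spectral gap. The derivative `p'` is the
commutator `[h, x]` with `x = p h' s² - s² h' p`. Hence, in the Heisenberg picture, the derivative
of `p + (i / T) x` is conjugate to `(i / T) x'`: the evolution transports the range of `p` along
itself up to an error of order `(1 + ‖x'‖) / T`, and `‖x'‖` is bounded by a constant plus a multiple
of `‖h''‖`, which is `o(T)`.
-/

namespace Adiabatic

/-- `s` is the group inverse of `k` and `p = 1 - k * s` is the complementary projection onto the
kernel of `k`. For `k = h - e` with `e` an isolated eigenvalue of `h`, these are the reduced
resolvent and the spectral projection of `h` at `e`. -/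
structure IsReducedInverse {𝔸 : Type*} [Ring 𝔸] (k p s : 𝔸) : Prop where
  mul_proj : k * p = 0
  inv_mul_proj : s * p = 0
  inv_mul : s * k = 1 - p
  mul_inv : k * s = 1 - p

/-- The first-order adiabatic correction to the projection `p` with reduced resolvent `s`, where
`d` is the derivative of the Hamiltonian; the factor `i / T` is left out. -/
def correction {𝔸 : Type*} [Ring 𝔸] (p s d : 𝔸) : 𝔸 :=
  p * d * (s * s) - s * s * d * p

namespace IsReducedInverse

section Ring

variable {𝔸 : Type*} [Ring 𝔸] {k k₀ p p₀ s s₀ : 𝔸}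

lemma proj_mul (hk : IsReducedInverse k p s) : p * k = 0 := by
  have hp : p = 1 - k * s := by rw [hk.mul_inv, sub_sub_cancel]
  calc p * k = k - k * (s * k) := by rw [hp]; noncomm_ring
    _ = 0 := by rw [hk.inv_mul, mul_sub, hk.mul_proj, mul_one, sub_zero, sub_self]

lemma proj_mul_inv (hk : IsReducedInverse k p s) : p * s = 0 := by
  have hp : p = 1 - s * k := by rw [hk.inv_mul, sub_sub_cancel]
  calc p * s = s - s * (k * s) := by rw [hp]; noncomm_ring
    _ = 0 := by rw [hk.mul_inv, mul_sub, hk.inv_mul_proj, mul_one, sub_zero, sub_self]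

lemma isIdempotentElem_proj (hk : IsReducedInverse k p s) : IsIdempotentElem p := by
  have h : (1 - p) * p = 0 := by rw [← hk.inv_mul, mul_assoc, hk.mul_proj, mul_zero]
  rwa [sub_mul, one_mul, sub_eq_zero, eq_comm] at h

lemma isSelfAdjoint_proj [StarRing 𝔸] (hk : IsReducedInverse k p s) (hk_sa : IsSelfAdjoint k)
    (hs_sa : IsSelfAdjoint s) : IsSelfAdjoint p := by
  have hp : p = 1 - k * s := by rw [hk.mul_inv, sub_sub_cancel]
  rw [IsSelfAdjoint, hp, star_sub, star_one, star_mul, hk_sa.star_eq, hs_sa.star_eq, hk.inv_mul,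
    hk.mul_inv]

lemma proj_sub_proj (hk : IsReducedInverse k p s) (hk₀ : IsReducedInverse k₀ p₀ s₀) :
    p - p₀ = -(s₀ * (k - k₀) * p) - p₀ * (k - k₀) * s := by
  have h₁ : s₀ * (k - k₀) * p = -((1 - p₀) * p) := by
    rw [mul_assoc, sub_mul, hk.mul_proj, zero_sub, mul_neg, ← mul_assoc, hk₀.inv_mul]
  have h₂ : p₀ * (k - k₀) * s = p₀ * (1 - p) := by
    rw [mul_sub, hk₀.proj_mul, sub_zero, mul_assoc, hk.mul_inv]
  rw [h₁, h₂]
  noncomm_ring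

lemma inv_sub_inv (hk : IsReducedInverse k p s) (hk₀ : IsReducedInverse k₀ p₀ s₀) :
    s - s₀ = -(s * (k - k₀) * s₀) - s * (p - p₀) - (p - p₀) * s₀ := by
  have h : s * (k - k₀) * s₀ = (1 - p) * s₀ - s * (1 - p₀) := by
    rw [mul_sub, sub_mul, hk.inv_mul, mul_assoc, hk₀.mul_inv]
  have hsp : s * (p - p₀) = -(s * p₀) := by rw [mul_sub, hk.inv_mul_proj, zero_sub]
  have hps : (p - p₀) * s₀ = p * s₀ := by rw [sub_mul, hk₀.proj_mul_inv, sub_zero]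
  rw [h, hsp, hps]
  noncomm_ring

lemma commutator_correction (hk : IsReducedInverse k p s) (d : 𝔸) :
    k * correction p s d - correction p s d * k = -(s * d * p) - p * d * s := by
  have hkss : k * (s * s) = s := by
    rw [← mul_assoc, hk.mul_inv, sub_mul, hk.proj_mul_inv, one_mul, sub_zero]
  have hssk : s * s * k = s := by
    rw [mul_assoc, hk.inv_mul, mul_sub, hk.inv_mul_proj, mul_one, sub_zero]
  have hleft : k * correction p s d = -(s * d * p) := by
    calc k * correction p s d = k * p * d * (s * s) - k * (s * s) * d * p := by
          rw [correction]; noncomm_ring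
      _ = -(s * d * p) := by rw [hk.mul_proj, hkss]; noncomm_ring
  have hright : correction p s d * k = p * d * s := by
    calc correction p s d * k = p * d * (s * s * k) - s * s * d * (p * k) := by
          rw [correction]; noncomm_ring
      _ = p * d * s := by rw [hk.proj_mul, hssk, mul_zero, sub_zero]
  rw [hleft, hright]

end Ring

end IsReducedInverse

section NormedRing

variable {𝔸 : Type*} [NormedRing 𝔸]

lemma norm_mul₃_le_of_le {a b c : 𝔸} {x y z : ℝ} (ha : ‖a‖ ≤ x) (hb : ‖b‖ ≤ y) (hc : ‖c‖ ≤ z) :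
    ‖a * b * c‖ ≤ x * y * z :=
  norm_mul_le_of_le (norm_mul_le_of_le ha hb) hc

lemma norm_smul_le_of_le {𝕜 E : Type*} [NormedField 𝕜] [SeminormedAddCommGroup E]
    [NormedSpace 𝕜 E] {r : 𝕜} {z : E} {x y : ℝ} (hr : ‖r‖ ≤ x) (hz : ‖z‖ ≤ y) :
    ‖r • z‖ ≤ x * y :=
  (norm_smul_le r z).trans (mul_le_mul hr hz (norm_nonneg z) ((norm_nonneg r).trans hr))

lemma norm_correction_le {p s d : 𝔸} {C c : ℝ} (hp : ‖p‖ ≤ 1) (hs : ‖s‖ ≤ c) (hd : ‖d‖ ≤ C) :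
    ‖correction p s d‖ ≤ 2 * C * c ^ 2 := by
  have hss : ‖s * s‖ ≤ c * c := norm_mul_le_of_le hs hs
  calc ‖correction p s d‖ ≤ 1 * C * (c * c) + c * c * C * 1 :=
        norm_sub_le_of_le (norm_mul₃_le_of_le hp hd hss) (norm_mul₃_le_of_le hss hd hp)
    _ = 2 * C * c ^ 2 := by ring

lemma norm_neg_mul_sub_mul_le {p s d : 𝔸} {C c : ℝ} (hp : ‖p‖ ≤ 1) (hs : ‖s‖ ≤ c)
    (hd : ‖d‖ ≤ C) : ‖-(s * d * p) - p * d * s‖ ≤ 2 * c * C := by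
  calc ‖-(s * d * p) - p * d * s‖ ≤ c * C * 1 + 1 * C * c :=
        norm_sub_le_of_le ((norm_neg _).trans_le (norm_mul₃_le_of_le hs hd hp))
          (norm_mul₃_le_of_le hp hd hs)
    _ = 2 * c * C := by ring

lemma exists_hasDerivWithinAt_mul₃ {𝕜 : Type*} [NontriviallyNormedField 𝕜] [NormedAlgebra 𝕜 𝔸]
    {f g h : 𝕜 → 𝔸} {f' g' h' : 𝔸} {I : Set 𝕜} {a : 𝕜} {F G H F' G' H' : ℝ}
    (hf : HasDerivWithinAt f f' I a) (hg : HasDerivWithinAt g g' I a)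
    (hh : HasDerivWithinAt h h' I a) (hF : ‖f a‖ ≤ F) (hG : ‖g a‖ ≤ G) (hH : ‖h a‖ ≤ H)
    (hF' : ‖f'‖ ≤ F') (hG' : ‖g'‖ ≤ G') (hH' : ‖h'‖ ≤ H') :
    ∃ D : 𝔸, HasDerivWithinAt (fun t => f t * g t * h t) D I a ∧
      ‖D‖ ≤ (F' * G + F * G') * H + F * G * H' :=
  ⟨_, (hf.mul hg).mul hh, norm_add_le_of_le
    (norm_mul_le_of_le (norm_add_le_of_le (norm_mul_le_of_le hF' hG) (norm_mul_le_of_le hF hG')) hH)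
    (norm_mul₃_le_of_le hF hG hH')⟩

lemma continuousOn_of_norm_sub_le {X E F : Type*} [TopologicalSpace X] [SeminormedAddCommGroup E]
    [SeminormedAddCommGroup F] {f : X → E} {g : X → F} {I : Set X} {C : ℝ}
    (hg : ContinuousOn g I) (h : ∀ t ∈ I, ∀ a ∈ I, ‖f t - f a‖ ≤ C * ‖g t - g a‖) :
    ContinuousOn f I := by
  intro a ha
  have hlim : Tendsto (fun t => C * ‖g t - g a‖) (𝓝[I] a) (𝓝 0) := by
    simpa only [mul_zero] using (tendsto_iff_norm_sub_tendsto_zero.1 (hg a ha)).const_mul C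
  refine tendsto_iff_norm_sub_tendsto_zero.2
    (squeeze_zero' (Eventually.of_forall fun _ => norm_nonneg _) ?_ hlim)
  filter_upwards [self_mem_nhdsWithin] with t ht using h t ht a ha

end NormedRing

namespace IsReducedInverse

section NormedRing

variable {𝔸 : Type*} [NormedRing 𝔸]

lemma norm_proj_sub_le {k k₀ p p₀ s s₀ : 𝔸} {c : ℝ} (hk : IsReducedInverse k p s)
    (hk₀ : IsReducedInverse k₀ p₀ s₀) (hp : ‖p‖ ≤ 1) (hp₀ : ‖p₀‖ ≤ 1) (hs : ‖s‖ ≤ c)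
    (hs₀ : ‖s₀‖ ≤ c) : ‖p - p₀‖ ≤ 2 * c * ‖k - k₀‖ := by
  rw [hk.proj_sub_proj hk₀]
  calc ‖-(s₀ * (k - k₀) * p) - p₀ * (k - k₀) * s‖ ≤ c * ‖k - k₀‖ * 1 + 1 * ‖k - k₀‖ * c :=
        norm_sub_le_of_le ((norm_neg _).trans_le (norm_mul₃_le_of_le hs₀ le_rfl hp))
          (norm_mul₃_le_of_le hp₀ le_rfl hs)
    _ = 2 * c * ‖k - k₀‖ := by ring

lemma norm_inv_sub_le {k k₀ p p₀ s s₀ : 𝔸} {c : ℝ} (hk : IsReducedInverse k p s)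
    (hk₀ : IsReducedInverse k₀ p₀ s₀) (hp : ‖p‖ ≤ 1) (hp₀ : ‖p₀‖ ≤ 1) (hs : ‖s‖ ≤ c)
    (hs₀ : ‖s₀‖ ≤ c) : ‖s - s₀‖ ≤ 5 * c ^ 2 * ‖k - k₀‖ := by
  have hpp₀ := hk.norm_proj_sub_le hk₀ hp hp₀ hs hs₀
  rw [hk.inv_sub_inv hk₀]
  calc ‖-(s * (k - k₀) * s₀) - s * (p - p₀) - (p - p₀) * s₀‖
      ≤ c * ‖k - k₀‖ * c + c * (2 * c * ‖k - k₀‖) + 2 * c * ‖k - k₀‖ * c :=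
        norm_sub_le_of_le (norm_sub_le_of_le
          ((norm_neg _).trans_le (norm_mul₃_le_of_le hs le_rfl hs₀))
          (norm_mul_le_of_le hs hpp₀)) (norm_mul_le_of_le hpp₀ hs₀)
    _ = 5 * c ^ 2 * ‖k - k₀‖ := by ring

variable {𝕜 : Type*} [NontriviallyNormedField 𝕜] [NormedAlgebra 𝕜 𝔸] {k p s : 𝕜 → 𝔸}
  {k' p' : 𝔸} {I : Set 𝕜} {a : 𝕜}

lemma hasDerivWithinAt_proj (hk : ∀ t ∈ I, IsReducedInverse (k t) (p t) (s t)) (ha : a ∈ I)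
    (hp : ContinuousWithinAt p I a) (hs : ContinuousWithinAt s I a)
    (hk' : HasDerivWithinAt k k' I a) :
    HasDerivWithinAt p (-(s a * k' * p a) - p a * k' * s a) I a := by
  have hslope := hasDerivWithinAt_iff_tendsto_slope.1 hk'
  have hp_lim : Tendsto p (𝓝[I \ {a}] a) (𝓝 (p a)) := hp.mono sdiff_subset
  have hs_lim : Tendsto s (𝓝[I \ {a}] a) (𝓝 (s a)) := hs.mono sdiff_subset
  refine hasDerivWithinAt_iff_tendsto_slope.2 <| Tendsto.congr' ?_ <|
    ((hslope.const_mul (s a)).mul hp_lim).neg.sub ((hslope.const_mul (p a)).mul hs_lim)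
  filter_upwards [self_mem_nhdsWithin] with t ht
  simp only [slope_def_module, mul_smul_comm, smul_mul_assoc]
  rw [(hk t ht.1).proj_sub_proj (hk a ha), smul_sub, smul_neg]

lemma hasDerivWithinAt_inv (hk : ∀ t ∈ I, IsReducedInverse (k t) (p t) (s t)) (ha : a ∈ I)
    (hs : ContinuousWithinAt s I a) (hk' : HasDerivWithinAt k k' I a)
    (hp' : HasDerivWithinAt p p' I a) :
    HasDerivWithinAt s (-(s a * k' * s a) - s a * p' - p' * s a) I a := by
  have hk_slope := hasDerivWithinAt_iff_tendsto_slope.1 hk'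
  have hp_slope := hasDerivWithinAt_iff_tendsto_slope.1 hp'
  have hs_lim : Tendsto s (𝓝[I \ {a}] a) (𝓝 (s a)) := hs.mono sdiff_subset
  refine hasDerivWithinAt_iff_tendsto_slope.2 <| Tendsto.congr' ?_ <|
    (((hs_lim.mul hk_slope).mul_const (s a)).neg.sub (hs_lim.mul hp_slope)).sub
      (hp_slope.mul_const (s a))
  filter_upwards [self_mem_nhdsWithin] with t ht
  simp only [slope_def_module, mul_smul_comm, smul_mul_assoc]
  rw [(hk t ht.1).inv_sub_inv (hk a ha), smul_sub, smul_sub, smul_neg]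

end NormedRing

end IsReducedInverse

/-- `e` is a continuous energy level of the Hamiltonian `h` on `I`, with spectral projection `p`
and reduced resolvent `s`; the bound `c` on the latter plays the role of the inverse spectral
gap. -/
structure IsIsolatedLevel {𝔸 : Type*} [NormedRing 𝔸] [NormedAlgebra ℝ 𝔸] (h p s : ℝ → 𝔸)
    (e : ℝ → ℝ) (I : Set ℝ) (c : ℝ) : Prop where
  continuousOn_level : ContinuousOn e I
  isReducedInverse : ∀ t ∈ I, IsReducedInverse (h t - e t • 1) (p t) (s t)
  norm_proj : ∀ t ∈ I, ‖p t‖ = 1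
  norm_inv_le : ∀ t ∈ I, ‖s t‖ ≤ c

namespace IsIsolatedLevel

variable {𝔸 : Type*} [NormedRing 𝔸] [NormedAlgebra ℝ 𝔸] {h p s : ℝ → 𝔸} {e : ℝ → ℝ} {I : Set ℝ}
  {c C : ℝ} {a : ℝ} {h' : 𝔸}

lemma mul_proj (L : IsIsolatedLevel h p s e I c) (ha : a ∈ I) : h a * p a = e a • p a := by
  have hkp := (L.isReducedInverse a ha).mul_proj
  rwa [sub_mul, smul_one_mul, sub_eq_zero] at hkp

lemma proj_mul (L : IsIsolatedLevel h p s e I c) (ha : a ∈ I) : p a * h a = e a • p a := by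
  have hpk := (L.isReducedInverse a ha).proj_mul
  rwa [mul_sub, mul_smul_one, sub_eq_zero] at hpk

lemma continuousOn_sub_smul_one (L : IsIsolatedLevel h p s e I c) (hh : ContinuousOn h I) :
    ContinuousOn (fun t => h t - e t • (1 : 𝔸)) I :=
  hh.sub (L.continuousOn_level.smul continuousOn_const)

lemma continuousOn_proj (L : IsIsolatedLevel h p s e I c) (hh : ContinuousOn h I) :
    ContinuousOn p I :=
  continuousOn_of_norm_sub_le (L.continuousOn_sub_smul_one hh) fun t ht a ha =>
    (L.isReducedInverse t ht).norm_proj_sub_le (L.isReducedInverse a ha) (L.norm_proj t ht).le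
      (L.norm_proj a ha).le (L.norm_inv_le t ht) (L.norm_inv_le a ha)

lemma continuousOn_inv (L : IsIsolatedLevel h p s e I c) (hh : ContinuousOn h I) :
    ContinuousOn s I :=
  continuousOn_of_norm_sub_le (L.continuousOn_sub_smul_one hh) fun t ht a ha =>
    (L.isReducedInverse t ht).norm_inv_sub_le (L.isReducedInverse a ha) (L.norm_proj t ht).le
      (L.norm_proj a ha).le (L.norm_inv_le t ht) (L.norm_inv_le a ha)

lemma slope_level_smul (L : IsIsolatedLevel h p s e I c) (ha : a ∈ I) {t : ℝ} (ht : t ∈ I) :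
    slope e a t • (p a * p t) = p a * slope h a t * p t := by
  simp only [slope_def_module, mul_smul_comm, smul_mul_assoc, smul_assoc, mul_sub, sub_mul,
    sub_smul, mul_assoc, L.mul_proj ht]
  rw [← mul_assoc (p a) (h a), L.proj_mul ha, smul_mul_assoc]

lemma exists_hasDerivWithinAt_level (L : IsIsolatedLevel h p s e I c) (hh : ContinuousOn h I)
    (ha : a ∈ I) (hh' : HasDerivWithinAt h h' I a) :
    ∃ e' : ℝ, HasDerivWithinAt e e' I a ∧ ‖e'‖ ≤ ‖h'‖ := by
  have hpa := L.norm_proj a ha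
  obtain ⟨φ, hφ_norm, hφ⟩ := exists_dual_vector ℝ (p a) (by rw [hpa]; exact one_ne_zero)
  have hp_lim : Tendsto p (𝓝[I \ {a}] a) (𝓝 (p a)) :=
    (L.continuousOn_proj hh a ha).mono sdiff_subset
  have hden : Tendsto (fun t => φ (p a * p t)) (𝓝[I \ {a}] a) (𝓝 1) := by
    have := (φ.continuous.tendsto _).comp (hp_lim.const_mul (p a))
    rwa [(L.isReducedInverse a ha).isIdempotentElem_proj.eq, hφ, hpa] at this
  have hnum : Tendsto (fun t => φ (p a * slope h a t * p t)) (𝓝[I \ {a}] a)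
      (𝓝 (φ (p a * h' * p a))) :=
    (φ.continuous.tendsto _).comp
      (((hasDerivWithinAt_iff_tendsto_slope.1 hh').const_mul (p a)).mul hp_lim)
  refine ⟨φ (p a * h' * p a), hasDerivWithinAt_iff_tendsto_slope.2 ?_, ?_⟩
  · rw [← div_one (φ _)]
    refine (hnum.div hden one_ne_zero).congr' ?_
    filter_upwards [self_mem_nhdsWithin, hden.eventually_ne one_ne_zero] with t ht hne
    rw [Pi.div_apply, ← L.slope_level_smul ha ht.1, map_smul, smul_eq_mul,
      mul_div_cancel_right₀ _ hne]
  · calc ‖φ (p a * h' * p a)‖ ≤ ‖φ‖ * ‖p a * h' * p a‖ := φ.le_opNorm _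
      _ ≤ 1 * (1 * ‖h'‖ * 1) := by
        rw [hφ_norm]
        gcongr
        exact norm_mul₃_le_of_le hpa.le le_rfl hpa.le
      _ = ‖h'‖ := by ring

lemma hasDerivWithinAt_proj (L : IsIsolatedLevel h p s e I c) (hh : ContinuousOn h I) (ha : a ∈ I)
    (hh' : HasDerivWithinAt h h' I a) :
    HasDerivWithinAt p (-(s a * h' * p a) - p a * h' * s a) I a := by
  obtain ⟨e', he', -⟩ := L.exists_hasDerivWithinAt_level hh ha hh'
  refine (IsReducedInverse.hasDerivWithinAt_proj L.isReducedInverse ha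
    (L.continuousOn_proj hh a ha) (L.continuousOn_inv hh a ha)
    (hh'.sub (he'.smul_const 1))).congr_deriv ?_
  simp only [mul_sub, sub_mul, mul_smul_one, smul_mul_assoc,
    (L.isReducedInverse a ha).inv_mul_proj, (L.isReducedInverse a ha).proj_mul_inv, smul_zero,
    sub_zero]

lemma exists_hasDerivWithinAt_inv (L : IsIsolatedLevel h p s e I c)
    (hh : ContinuousOn h I) (ha : a ∈ I) (hh' : HasDerivWithinAt h h' I a) (hC : ‖h'‖ ≤ C) :
    ∃ s' : 𝔸, HasDerivWithinAt s s' I a ∧ ‖s'‖ ≤ 6 * C * c ^ 2 := by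
  obtain ⟨e', he', he'_le⟩ := L.exists_hasDerivWithinAt_level hh ha hh'
  have hs := L.norm_inv_le a ha
  have hp' := norm_neg_mul_sub_mul_le (L.norm_proj a ha).le hs hC
  have hk' : ‖s a * (h' - e' • 1) * s a‖ ≤ c * C * c + C * (c * c) := by
    rw [mul_sub, sub_mul, mul_smul_one, smul_mul_assoc]
    exact norm_sub_le_of_le (norm_mul₃_le_of_le hs hC hs)
      (norm_smul_le_of_le (he'_le.trans hC) (norm_mul_le_of_le hs hs))
  refine ⟨_, IsReducedInverse.hasDerivWithinAt_inv L.isReducedInverse ha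
    (L.continuousOn_inv hh a ha) (hh'.sub (he'.smul_const 1))
    (L.hasDerivWithinAt_proj hh ha hh'), ?_⟩
  refine (norm_sub_le_of_le (norm_sub_le_of_le
    ((norm_neg _).trans_le hk') (norm_mul_le_of_le hs hp'))
    (norm_mul_le_of_le hp' hs)).trans_eq ?_
  ring

lemma exists_hasDerivWithinAt_correction {d : ℝ → 𝔸} {d' : 𝔸} {B : ℝ}
    (L : IsIsolatedLevel h p s e I c) (hh : ContinuousOn h I) (ha : a ∈ I)
    (hh' : HasDerivWithinAt h (d a) I a) (hd' : HasDerivWithinAt d d' I a) (hC : ‖d a‖ ≤ C)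
    (hB : ‖d'‖ ≤ B) :
    ∃ x' : 𝔸, HasDerivWithinAt (fun t => correction (p t) (s t) (d t)) x' I a ∧
      ‖x'‖ ≤ 2 * B * c ^ 2 + 28 * C ^ 2 * c ^ 3 := by
  obtain ⟨s', hs', hs'_le⟩ := L.exists_hasDerivWithinAt_inv hh ha hh' hC
  have hp' := L.hasDerivWithinAt_proj hh ha hh'
  have hp := (L.norm_proj a ha).le
  have hs := L.norm_inv_le a ha
  have hp'_le := norm_neg_mul_sub_mul_le hp hs hC
  have hss : ‖(s * s) a‖ ≤ c * c := norm_mul_le_of_le hs hs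
  have hss'_le : ‖s' * s a + s a * s'‖ ≤ 6 * C * c ^ 2 * c + c * (6 * C * c ^ 2) :=
    norm_add_le_of_le (norm_mul_le_of_le hs'_le hs) (norm_mul_le_of_le hs hs'_le)
  obtain ⟨u', hu', hu'_le⟩ :=
    exists_hasDerivWithinAt_mul₃ hp' hd' (hs'.mul hs') hp hC hss hp'_le hB hss'_le
  obtain ⟨v', hv', hv'_le⟩ :=
    exists_hasDerivWithinAt_mul₃ (hs'.mul hs') hd' hp' hss hC hp hss'_le hB hp'_le
  refine ⟨u' - v', hu'.sub hv', (norm_sub_le_of_le hu'_le hv'_le).trans_eq ?_⟩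
  ring

end IsIsolatedLevel

lemma norm_one_sub_mul_mul_le {𝔸 : Type*} [NormedRing 𝔸] [StarRing 𝔸] [CStarRing 𝔸] {p q u : 𝔸}
    (hp : IsIdempotentElem p) (hp_norm : ‖p‖ ≤ 1) (hu : u ∈ unitary 𝔸) :
    ‖(1 - q) * u * p‖ ≤ ‖star u * q * u - p‖ := by
  have heq : (1 - q) * u * p = -(u * ((star u * q * u - p) * p)) := by
    calc (1 - q) * u * p = u * (p * p) - (u * star u) * q * u * p := by
          rw [hp.eq, Unitary.mul_star_self_of_mem hu]; noncomm_ring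
      _ = -(u * ((star u * q * u - p) * p)) := by noncomm_ring
  rw [heq, norm_neg, CStarRing.norm_mem_unitary_mul _ hu]
  exact (norm_mul_le _ _).trans (mul_le_of_le_one_right (norm_nonneg _) hp_norm)

section Evolution

variable {𝔸 : Type*} [NormedRing 𝔸] [StarRing 𝔸] [CStarRing 𝔸] [NormedAlgebra ℂ 𝔸]
  [StarModule ℂ 𝔸] {T : ℝ} {h U : ℝ → 𝔸} {I : Set ℝ}

lemma hasDerivWithinAt_heisenberg {a : ℝ} {y : ℝ → 𝔸} {y' : 𝔸} (hh : IsSelfAdjoint (h a))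
    (hU : HasDerivWithinAt U ((-(Complex.I * (T : ℂ))) • (h a * U a)) I a)
    (hy : HasDerivWithinAt y y' I a) :
    HasDerivWithinAt (fun t => star (U t) * y t * U t)
      (star (U a) * (y' + (Complex.I * (T : ℂ)) • (h a * y a - y a * h a)) * U a) I a := by
  refine ((hU.star.mul hy).mul hU).congr_deriv ?_
  simp only [star_smul, star_mul, hh.star_eq, star_neg, Complex.star_def, Complex.conj_I,
    Complex.conj_ofReal, neg_neg, Pi.mul_apply, mul_neg, neg_smul, smul_mul_assoc,
    mul_smul_comm, mul_sub, sub_mul, mul_add, add_mul, smul_sub, mul_assoc,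
    mul_comm (T : ℂ) Complex.I]
  abel

lemma mem_unitary_of_schrodinger [IsDedekindFiniteMonoid 𝔸] (hI : Convex ℝ I) {a b : ℝ}
    (ha : a ∈ I) (hb : b ∈ I) (hh : ∀ t ∈ I, IsSelfAdjoint (h t)) (hUa : U a ∈ unitary 𝔸)
    (hU : ∀ t ∈ I, HasDerivWithinAt U ((-(Complex.I * (T : ℂ))) • (h t * U t)) I t) :
    U b ∈ unitary 𝔸 := by
  have hderiv : ∀ t ∈ I, HasDerivWithinAt (fun t => star (U t) * 1 * U t) 0 I t := fun t ht =>
    (hasDerivWithinAt_heisenberg (hh t ht) (hU t ht)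
      (hasDerivWithinAt_const t I (1 : 𝔸))).congr_deriv (by simp)
  have hconst := hI.norm_image_sub_le_of_norm_hasDerivWithin_le hderiv (C := 0) (by simp) ha hb
  have hone : star (U b) * U b = 1 := by
    simpa [sub_eq_zero, Unitary.star_mul_self_of_mem hUa] using hconst
  exact Unitary.mem_iff.2 ⟨hone, mul_eq_one_comm.1 hone⟩

/-- With `y = p + (i / T) • x`, the two terms of the Heisenberg equation for `y` of order one
cancel: `p' = [h, x]` against `i T [h, (i / T) x] = -[h, x]`. -/
lemma norm_star_mul_mul_sub_le_of_deriv_eq_commutator (hT : 0 < T) (hI : Convex ℝ I) {a b : ℝ}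
    (ha : a ∈ I) (hb : b ∈ I) {p x x' : ℝ → 𝔸} {X M : ℝ} (hh : ∀ t ∈ I, IsSelfAdjoint (h t))
    (hU_unitary : ∀ t ∈ I, U t ∈ unitary 𝔸)
    (hU : ∀ t ∈ I, HasDerivWithinAt U ((-(Complex.I * (T : ℂ))) • (h t * U t)) I t)
    (hcomm : ∀ t ∈ I, Commute (h t) (p t))
    (hp : ∀ t ∈ I, HasDerivWithinAt p (h t * x t - x t * h t) I t)
    (hx : ∀ t ∈ I, HasDerivWithinAt x (x' t) I t) (hX : ∀ t ∈ I, ‖x t‖ ≤ X)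
    (hM : ∀ t ∈ I, ‖x' t‖ ≤ M) :
    ‖star (U b) * p b * U b - star (U a) * p a * U a‖ ≤ (2 * X + M * ‖b - a‖) / T := by
  set τ : ℂ := Complex.I * (T : ℂ)⁻¹ with hτ
  have hτ_norm : ‖τ‖ = T⁻¹ := by simp [hτ, abs_of_pos hT]
  have hτ_mul : Complex.I * (T : ℂ) * τ = -1 := by
    rw [hτ, mul_mul_mul_comm, Complex.I_mul_I, mul_inv_cancel₀ (by exact_mod_cast hT.ne'), mul_one]
  have hconj : ∀ t ∈ I, ∀ z : 𝔸, ‖star (U t) * z * U t‖ = ‖z‖ := fun t ht z => by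
    rw [CStarRing.norm_mul_mem_unitary _ (hU_unitary t ht),
      CStarRing.norm_mem_unitary_mul _ (Unitary.star_mem (hU_unitary t ht))]
  have hsmall : ∀ t ∈ I, ‖star (U t) * (τ • x t) * U t‖ ≤ T⁻¹ * X := fun t ht => by
    rw [hconj t ht]
    exact norm_smul_le_of_le hτ_norm.le (hX t ht)
  have hderiv : ∀ t ∈ I, HasDerivWithinAt (fun t => star (U t) * (p t + τ • x t) * U t)
      (star (U t) * (τ • x' t) * U t) I t := fun t ht => by
    have hy : HasDerivWithinAt (fun t => p t + τ • x t) (h t * x t - x t * h t + τ • x' t) I t :=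
      (hp t ht).add ((hx t ht).fun_const_smul τ)
    have hy_comm : h t * (p t + τ • x t) - (p t + τ • x t) * h t
        = τ • (h t * x t - x t * h t) := by
      rw [mul_add, add_mul, (hcomm t ht).eq, mul_smul_comm, smul_mul_assoc, smul_sub]
      abel
    refine (hasDerivWithinAt_heisenberg (hh t ht) (hU t ht) hy).congr_deriv ?_
    rw [hy_comm, smul_smul, hτ_mul, neg_one_smul, add_neg_cancel_comm]
  have hdiff : ‖star (U b) * (p b + τ • x b) * U b - star (U a) * (p a + τ • x a) * U a‖
      ≤ T⁻¹ * M * ‖b - a‖ :=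
    hI.norm_image_sub_le_of_norm_hasDerivWithin_le hderiv (fun t ht =>
      (hconj t ht _).trans_le (norm_smul_le_of_le hτ_norm.le (hM t ht))) ha hb
  calc ‖star (U b) * p b * U b - star (U a) * p a * U a‖
      = ‖star (U b) * (p b + τ • x b) * U b - star (U a) * (p a + τ • x a) * U a
          - star (U b) * (τ • x b) * U b + star (U a) * (τ • x a) * U a‖ := by
        congr 1; noncomm_ring
    _ ≤ T⁻¹ * M * ‖b - a‖ + T⁻¹ * X + T⁻¹ * X :=
        norm_add_le_of_le (norm_sub_le_of_le hdiff (hsmall b hb)) (hsmall a ha)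
    _ = (2 * X + M * ‖b - a‖) / T := by ring

theorem IsIsolatedLevel.norm_one_sub_proj_mul_evolution_mul_proj_le
    {h' h'' p s : ℝ → 𝔸} {e : ℝ → ℝ} {a b c C B : ℝ} (L : IsIsolatedLevel h p s e I c)
    (hT : 0 < T) (hI : Convex ℝ I) (ha : a ∈ I) (hb : b ∈ I)
    (hh : ∀ t ∈ I, IsSelfAdjoint (h t)) (hh' : ∀ t ∈ I, HasDerivWithinAt h (h' t) I t)
    (hh'' : ∀ t ∈ I, HasDerivWithinAt h' (h'' t) I t) (hC : ∀ t ∈ I, ‖h' t‖ ≤ C)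
    (hB : ∀ t ∈ I, ‖h'' t‖ ≤ B) (hUa : U a = 1) (hU_unitary : ∀ t ∈ I, U t ∈ unitary 𝔸)
    (hU : ∀ t ∈ I, HasDerivWithinAt U ((-(Complex.I * (T : ℂ))) • (h t * U t)) I t) :
    ‖(1 - p b) * U b * p a‖ ≤
      (4 * C * c ^ 2 + (2 * B * c ^ 2 + 28 * C ^ 2 * c ^ 3) * ‖b - a‖) / T := by
  have hh_cont : ContinuousOn h I := fun t ht => (hh' t ht).continuousWithinAt
  have hp : ∀ t ∈ I, HasDerivWithinAt p
      (h t * correction (p t) (s t) (h' t) - correction (p t) (s t) (h' t) * h t) I t :=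
    fun t ht => (L.hasDerivWithinAt_proj hh_cont ht (hh' t ht)).congr_deriv <| by
      rw [← (L.isReducedInverse t ht).commutator_correction, sub_mul, mul_sub, smul_one_mul,
        mul_smul_one, sub_sub_sub_cancel_right]
  choose! x' hx' hx'_le using fun t ht =>
    L.exists_hasDerivWithinAt_correction hh_cont ht (hh' t ht) (hh'' t ht) (hC t ht) (hB t ht)
  have hbound := norm_star_mul_mul_sub_le_of_deriv_eq_commutator hT hI ha hb hh hU_unitary hU
    (fun t ht => (L.mul_proj ht).trans (L.proj_mul ht).symm) hp hx'
    (fun t ht => norm_correction_le (L.norm_proj t ht).le (L.norm_inv_le t ht) (hC t ht)) hx'_le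
  calc ‖(1 - p b) * U b * p a‖ ≤ ‖star (U b) * p b * U b - p a‖ :=
        norm_one_sub_mul_mul_le (L.isReducedInverse a ha).isIdempotentElem_proj
          (L.norm_proj a ha).le (hU_unitary b hb)
    _ ≤ (2 * (2 * C * c ^ 2) + (2 * B * c ^ 2 + 28 * C ^ 2 * c ^ 3) * ‖b - a‖) / T := by
        simpa only [hUa, star_one, one_mul, mul_one] using hbound
    _ = (4 * C * c ^ 2 + (2 * B * c ^ 2 + 28 * C ^ 2 * c ^ 3) * ‖b - a‖) / T := by ring

end Evolution

/-- As `0⁻¹ = 0`, the function `x⁻¹` annihilates the kernel of `k` and inverts `k` off it. -/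
lemma isReducedInverse_cfc_inv {𝔸 : Type*} [CStarAlgebra 𝔸] {k : 𝔸} (hk : IsSelfAdjoint k)
    (hinv : ContinuousOn (fun x : ℝ => x⁻¹) (spectrum ℝ k)) :
    IsReducedInverse k (1 - k * cfc (fun x : ℝ => x⁻¹) k) (cfc (fun x : ℝ => x⁻¹) k) := by
  set s := cfc (fun x : ℝ => x⁻¹) k
  have hcomm : Commute s k := Commute.cfc_real rfl (fun x => x⁻¹)
  have hid : cfc (fun x : ℝ => x) k = k := cfc_id' ℝ k
  have hks : k * s = cfc (fun x : ℝ => x * x⁻¹) k := by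
    rw [cfc_mul (fun x : ℝ => x) _ k, hid]
  have hone : ContinuousOn (fun x : ℝ => x * x⁻¹) (spectrum ℝ k) := continuousOn_id.mul hinv
  have hkks : k * (k * s) = k := by
    calc k * (k * s) = cfc (fun x : ℝ => x * (x * x⁻¹)) k := by
          rw [cfc_mul (fun x : ℝ => x) _ k continuousOn_id hone, hid, hks]
      _ = k := by simp only [← mul_assoc, mul_self_mul_inv, hid]
  have hsks : s * (k * s) = s := by
    calc s * (k * s) = cfc (fun x : ℝ => x⁻¹ * (x * x⁻¹)) k := by
          rw [cfc_mul _ _ k hinv hone, hks]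
      _ = s := cfc_congr fun x _ => by grind
  exact ⟨by rw [mul_sub, mul_one, hkks, sub_self], by rw [mul_sub, mul_one, hsks, sub_self],
    by rw [hcomm.eq, sub_sub_cancel], (sub_sub_cancel _ _).symm⟩

lemma enorm_inv_le_inv_einfsep_spectrum {𝔸 : Type*} [Ring 𝔸] [Algebra ℝ 𝔸] [Algebra ℂ 𝔸]
    [IsScalarTower ℝ ℂ 𝔸] {a : 𝔸} {e t : ℝ} (he : (e : ℂ) ∈ spectrum ℂ a)
    (ht : t ∈ spectrum ℝ (a - e • (1 : 𝔸))) : ‖t⁻¹‖ₑ ≤ (spectrum ℂ a).einfsep⁻¹ := by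
  rcases eq_or_ne t 0 with rfl | ht₀
  · simp
  have ht' : ((t + e : ℝ) : ℂ) ∈ spectrum ℂ a := by
    rw [← Algebra.algebraMap_eq_smul_one, ← spectrum.add_mem_add_iff (s := e),
      add_sub_cancel] at ht
    exact (spectrum.algebraMap_mem_iff ℂ).2 ht
  have hdist := einfsep_le_edist_of_mem ht' he (by simpa using ht₀)
  rw [edist_eq_enorm_sub, ← Complex.ofReal_sub, add_sub_cancel_right] at hdist
  rw [enorm_inv ht₀, ENNReal.inv_le_inv]
  simpa [enorm_eq_nnnorm] using hdist

section Matrices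

variable {N : ℕ}

lemma toEuclideanLin_proj (v : State N) :
    Matrix.toEuclideanLin (proj v) = InnerProductSpace.rankOne ℂ v v := by
  rw [← LinearEquiv.eq_symm_apply, InnerProductSpace.symm_toEuclideanLin_rankOne]
  rfl

lemma norm_proj (v : State N) : ‖proj v‖ = ‖v‖ ^ 2 := by
  rw [Matrix.l2_opNorm_def, sq, ← InnerProductSpace.norm_rankOne (𝕜 := ℂ)]
  congr 1
  exact ContinuousLinearMap.coe_injective (toEuclideanLin_proj v)

lemma toEuclideanLin_mul_apply (A B : Mat N) (w : State N) :
    Matrix.toEuclideanLin (A * B) w = Matrix.toEuclideanLin A (Matrix.toEuclideanLin B w) := by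
  rw [Matrix.toLpLin_mul_same, LinearMap.comp_apply]

lemma toEuclideanLin_proj_self {v : State N} (hv : ‖v‖ = 1) :
    Matrix.toEuclideanLin (proj v) v = v := by
  rw [toEuclideanLin_proj, ContinuousLinearMap.coe_coe, InnerProductSpace.rankOne_apply,
    inner_self_eq_norm_sq_to_K, hv, RCLike.ofReal_one, one_pow, one_smul]

lemma norm_toEuclideanLin_le_norm_mul_proj (A : Mat N) {v : State N} (hv : ‖v‖ = 1) :
    ‖Matrix.toEuclideanLin A v‖ ≤ ‖A * proj v‖ := by
  calc ‖Matrix.toEuclideanLin A v‖ = ‖Matrix.toEuclideanLin (A * proj v) v‖ := by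
        rw [toEuclideanLin_mul_apply, toEuclideanLin_proj_self hv]
    _ ≤ ‖A * proj v‖ * ‖v‖ := Matrix.l2_opNorm_mulVec (A * proj v) v
    _ = ‖A * proj v‖ := by rw [hv, mul_one]

lemma IsReducedInverse.eq_proj_of_ker_eq_span {k q s : Mat N} {v : State N}
    (hk : IsReducedInverse k q s) (hq : IsSelfAdjoint q) (hv : ‖v‖ = 1)
    (hker : LinearMap.ker (Matrix.toEuclideanLin k) = Submodule.span ℂ {v}) : q = proj v := by
  have hkv : Matrix.toEuclideanLin k v = 0 := by
    rw [← LinearMap.mem_ker, hker]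
    exact Submodule.mem_span_singleton_self v
  have hqv : Matrix.toEuclideanLin q v = v := by
    have h := toEuclideanLin_mul_apply s k v
    rwa [hkv, map_zero, hk.inv_mul, map_sub, LinearMap.sub_apply, Matrix.toLpLin_one,
      LinearMap.id_apply, sub_eq_zero, eq_comm] at h
  refine Matrix.toEuclideanLin.injective (LinearMap.ext fun w => ?_)
  have hqw : Matrix.toEuclideanLin q w ∈ LinearMap.ker (Matrix.toEuclideanLin k) := by
    rw [LinearMap.mem_ker, ← toEuclideanLin_mul_apply, hk.mul_proj, map_zero, LinearMap.zero_apply]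
  rw [hker, Submodule.mem_span_singleton] at hqw
  obtain ⟨α, hα⟩ := hqw
  have hinner : inner ℂ v w = α := by
    calc inner ℂ v w = inner ℂ v (α • v) := by
          rw [hα, ← Matrix.isSymmetric_toEuclideanLin_iff.2 hq, hqv]
      _ = α := by
        rw [inner_smul_right, inner_self_eq_norm_sq_to_K, hv, RCLike.ofReal_one, one_pow, mul_one]
  rw [← hα, toEuclideanLin_proj, ContinuousLinearMap.coe_coe, InnerProductSpace.rankOne_apply,
    hinner]

namespace IsNondegenerateEigenstate

variable {H : ℝ → Mat N} {E : ℝ → ℝ} {G : ℝ → State N} {t : ℝ}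

lemma energy_mem_spectrum (hG : IsNondegenerateEigenstate H E G) (ht : t ∈ Icc (0 : ℝ) 1) :
    (E t : ℂ) ∈ spectrum ℂ (H t) := by
  rw [← Matrix.spectrum_toLpLin 2, ← Module.End.hasEigenvalue_iff_mem_spectrum]
  refine Module.End.hasEigenvalue_of_hasEigenvector
    ⟨Module.End.mem_eigenspace_iff.2 (hG.eigenvector t ht), ?_⟩
  exact norm_ne_zero_iff.1 (by rw [hG.norm_eq_one t ht]; exact one_ne_zero)

lemma ker_eq_span (hG : IsNondegenerateEigenstate H E G) (ht : t ∈ Icc (0 : ℝ) 1) :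
    LinearMap.ker (Matrix.toEuclideanLin (H t - E t • 1)) = Submodule.span ℂ {G t} := by
  have hG₀ : G t ≠ 0 := norm_ne_zero_iff.1 (by rw [hG.norm_eq_one t ht]; exact one_ne_zero)
  have heq : Matrix.toEuclideanLin (H t - E t • 1)
      = Matrix.toEuclideanLin (H t) - (E t : ℂ) • 1 := by
    rw [map_sub, ← Complex.coe_smul, map_smul, Matrix.toLpLin_one]
    rfl
  rw [heq, ← Module.End.eigenspace_def]
  refine (Submodule.eq_of_le_of_finrank_eq ?_ ?_).symm
  · rw [Submodule.span_singleton_le_iff_mem, Module.End.mem_eigenspace_iff]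
    exact hG.eigenvector t ht
  · rw [finrank_span_singleton hG₀, hG.nondegenerate t ht]

lemma isIsolatedLevel {c : ℝ≥0} (hG : IsNondegenerateEigenstate H E G)
    (hH : ∀ t ∈ Icc (0 : ℝ) 1, (H t).IsHermitian) (hgap : (gapMin H)⁻¹ ≤ c) :
    IsIsolatedLevel H (fun t => proj (G t)) (fun t => cfc (fun x : ℝ => x⁻¹) (H t - E t • 1)) E
      (Icc 0 1) c where
  continuousOn_level := hG.continuousOn_energy
  isReducedInverse t ht := by
    have hk : IsSelfAdjoint (H t - E t • 1) :=
      (hH t ht).isSelfAdjoint.sub (IsSelfAdjoint.smul (.all _) (.one _))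
    have hred := isReducedInverse_cfc_inv hk (Matrix.finite_real_spectrum.continuousOn _)
    have hq := hred.isSelfAdjoint_proj hk IsSelfAdjoint.cfc
    rwa [hred.eq_proj_of_ker_eq_span hq (hG.norm_eq_one t ht) (hG.ker_eq_span ht)] at hred
  norm_proj t ht := by rw [norm_proj, hG.norm_eq_one t ht, one_pow]
  norm_inv_le t ht := norm_cfc_le c.coe_nonneg fun x hx => by
    have h : ‖x⁻¹‖ₑ ≤ c :=
      (enorm_inv_le_inv_einfsep_spectrum (hG.energy_mem_spectrum ht) hx).trans <|
        (ENNReal.inv_le_inv.2 (iInf₂_le t ht)).trans hgap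
    exact_mod_cast h

end IsNondegenerateEigenstate

lemma norm_le_of_supNorm_le {A : ℝ → Mat N} {C : ℝ≥0} (hA : supNorm A ≤ C) {t : ℝ}
    (ht : t ∈ Icc (0 : ℝ) 1) : ‖A t‖ ≤ C := by
  have h : ‖A t‖ₑ ≤ C := (le_iSup₂ (f := fun s (_ : s ∈ Icc (0 : ℝ) 1) => ‖A s‖ₑ) t ht).trans hA
  exact_mod_cast h

theorem adiabaticError_le {T : ℝ} {H U : ℝ → Mat N} {E : ℝ → ℝ} {G : ℝ → State N} {C B c : ℝ≥0}
    (hT : 0 < T) (hH : ∀ t ∈ Icc (0 : ℝ) 1, (H t).IsHermitian) (hH_diff : TwiceDifferentiable H)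
    (hG : IsNondegenerateEigenstate H E G) (hU : IsEvolution T H U)
    (hC : supNorm (dot H) ≤ C) (hB : supNorm (dot (dot H)) ≤ B) (hgap : (gapMin H)⁻¹ ≤ c) :
    adiabaticError G U ≤ (4 * C * c ^ 2 + 28 * C ^ 2 * c ^ 3 + 2 * c ^ 2 * B) / T := by
  have h₀ : (0 : ℝ) ∈ Icc (0 : ℝ) 1 := left_mem_Icc.2 zero_le_one
  have h₁ : (1 : ℝ) ∈ Icc (0 : ℝ) 1 := right_mem_Icc.2 zero_le_one
  have hU_unitary : ∀ t ∈ Icc (0 : ℝ) 1, U t ∈ unitary (Mat N) := fun t ht =>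
    mem_unitary_of_schrodinger (convex_Icc 0 1) h₀ ht (fun t ht => (hH t ht).isSelfAdjoint)
      (hU.initial ▸ one_mem _) hU.schrodinger
  calc adiabaticError G U ≤ ‖(1 - proj (G 1)) * U 1 * proj (G 0)‖ :=
        norm_toEuclideanLin_le_norm_mul_proj _ (hG.norm_eq_one 0 h₀)
    _ ≤ (4 * C * c ^ 2 + (2 * B * c ^ 2 + 28 * C ^ 2 * c ^ 3) * ‖(1 : ℝ) - 0‖) / T :=
        (hG.isIsolatedLevel hH hgap).norm_one_sub_proj_mul_evolution_mul_proj_le hT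
          (convex_Icc 0 1) h₀ h₁ (fun t ht => (hH t ht).isSelfAdjoint)
          (fun t ht => (hH_diff.1 t ht).hasDerivWithinAt)
          (fun t ht => (hH_diff.2 t ht).hasDerivWithinAt) (fun t => norm_le_of_supNorm_le hC)
          (fun t => norm_le_of_supNorm_le hB) hU.initial hU_unitary hU.schrodinger
    _ = (4 * C * c ^ 2 + 28 * C ^ 2 * c ^ 3 + 2 * c ^ 2 * B) / T := by
        rw [sub_zero, norm_one]; ring

end Matrices

end Adiabatic

theorem corollary2 {N : ℕ} (H U : ℝ → ℝ → Adiabatic.Mat N)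
    (E : ℝ → ℝ → ℝ) (G : ℝ → ℝ → Adiabatic.State N)
    (hHerm : ∀ T > 0, ∀ s ∈ Icc (0 : ℝ) 1, (H T s).IsHermitian)
    (hDiff : ∀ T > 0, Adiabatic.TwiceDifferentiable (H T))
    (hG : ∀ T > 0, Adiabatic.IsNondegenerateEigenstate (H T) (E T) (G T))
    (hU : ∀ T > 0, Adiabatic.IsEvolution T (H T) (U T))
    (hDot : ∃ C : ℝ≥0, ∀ T > 0, Adiabatic.supNorm (Adiabatic.dot (H T)) ≤ C)
    (hGap : ∃ C : ℝ≥0, ∀ T > 0, (Adiabatic.gapMin (H T))⁻¹ ≤ C)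
    (hDdot : Tendsto
      (fun T : ℝ => Adiabatic.supNorm (Adiabatic.dot (Adiabatic.dot (H T))) / ENNReal.ofReal T)
      atTop (𝓝 0)) :
    Tendsto (fun T : ℝ => Adiabatic.adiabaticError (G T) (U T)) atTop (𝓝 0) := by
  obtain ⟨C, hC⟩ := hDot
  obtain ⟨c, hc⟩ := hGap
  have hlim : Tendsto (fun T : ℝ => (4 * C * c ^ 2 + 28 * C ^ 2 * c ^ 3) * T⁻¹ + 2 * c ^ 2 *
      (Adiabatic.supNorm (Adiabatic.dot (Adiabatic.dot (H T))) / ENNReal.ofReal T).toReal)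
      atTop (𝓝 0) := by
    simpa only [mul_zero, add_zero, ENNReal.toReal_zero, Function.comp_apply] using
      (tendsto_inv_atTop_zero.const_mul (4 * C * c ^ 2 + 28 * C ^ 2 * c ^ 3 : ℝ)).add
        (((ENNReal.tendsto_toReal ENNReal.zero_ne_top).comp hDdot).const_mul (2 * c ^ 2 : ℝ))
  refine squeeze_zero' (Eventually.of_forall fun _ => norm_nonneg _) ?_ hlim
  filter_upwards [eventually_gt_atTop 0, hDdot.eventually_lt_const ENNReal.zero_lt_top]
    with T hT hfin
  have hB : Adiabatic.supNorm (Adiabatic.dot (Adiabatic.dot (H T))) ≠ ∞ := fun htop => by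
    simp [htop, ENNReal.top_div] at hfin
  calc Adiabatic.adiabaticError (G T) (U T)
      ≤ (4 * C * c ^ 2 + 28 * C ^ 2 * c ^ 3 + 2 * c ^ 2 *
          (Adiabatic.supNorm (Adiabatic.dot (Adiabatic.dot (H T)))).toNNReal) / T :=
        Adiabatic.adiabaticError_le hT (hHerm T hT) (hDiff T hT) (hG T hT) (hU T hT) (hC T hT)
          (ENNReal.coe_toNNReal hB).ge (hc T hT)
    _ = _ := by
        rw [ENNReal.toReal_div, ENNReal.toReal_ofReal hT.le, ENNReal.coe_toNNReal_eq_toReal]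
        ring
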